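/- Let $\mathcal O$ be a Dedekind domain, $\mathfrak p$ a nonzero prime ideal of $\mathcal O$ with finite residue field of cardinality $q$, and $\pi$ a generator of the maximal ideal of $\mathcal O_{\mathfrak p}$. Let $R$ be an $\mathcal O_{\mathfrak p}$-algebra that is a $\pi$-torsion free, $\pi$-adically complete discrete valuation ring, with an $\mathcal O_{\mathfrak p}$-linear endomorphism $\phi$ such that $\phi(x)\equiv x^q \bmod \pi$ for all $x$; put $S=\operatorname{Spf}R$. All functors below are functors of $\pi$-adically complete $R$-algebras $B$, with structure map $f:R\to B$, and $B^\phi$ is the ring $B$ with structure map $f\circ\phi$; likewise $R^\phi$. Let $W_n(B)$ be the ring of $\pi$-typical Witt vectors of length $n+1$ (with underlying set $B^{n+1}$ and ghost components $w_i=\sum_{j\le i}\pi^j x_j^{q^{i-j}}$), which is an $R$-algebra through $R\xrightarrow{\exp_\delta}W_n(R)\to W_n(B)$, where $\exp_\delta(r)$ has ghost components $r,\phi(r),\dots,\phi^n(r)$. Let $F:W_{n+1}(B)\to W_n(B^\phi)$ be the Frobenius. For a $\pi$-formal scheme $X$ over $S$ let $J^nX(B)=X(W_n(B))$; let $\phi:J^{n+1}X\to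 J^nX$ be the morphism over $\phi:S\to S$ given by $X(F):J^{n+1}X(B)\to J^nX(B^\phi)$, and let $u:J^{m+n}X\to J^mX$ be the projection given by truncation. Let $P\in X(R)$ be a marked point, let $P^m=X(\exp_\delta)(P)\in J^mX(R)$, let $N^{[m]n}X=J^{m+n}X\times_{J^mX}S$ be the fibre of $u$ over $P^m$, and let $\iota_m:N^{[m]n}X\to J^{m+n}X$ be the projection. Let $W_{[m]n}(B)=W_m(R)\times_{W_m(B)}W_{m+n}(B)$ and $W_{[m]n}(B^\phi)=W_m(R^\phi)\times_{W_m(B^\phi)}W_{m+n}(B^\phi)$, and let $I_{[m]n}$ be the projections to $W_{m+n}(B)$ and to $W_{m+n}(B^\phi)$. Let $\kappa_m$ be the maps induced by $X(I_{[m]n})$ from the set of points $g\in X(W_{[m]n}(B))$ whose image in $X(W_m(R))$ is $P^m$ to $N^{[m]n}X(B)$, and from the set of points $g\in X(W_{[m]n}(B^\phi))$ whose image in $X(W_m(R^\phi))$ is the image of $P^m$ to $N^{[m]n}X(B^\phi)$. For $m\ge1$ let $E_{[m]}:W_{[m]n}(B)\to W_{[m-1]n}(B^\phi)$ be the ring homomorphism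 given by $F$ on both factors; then $X(E_{[m]})$ maps the former set of points for $m$ to the latter one for $m-1$. Then for all $m\ge1$ and $n\ge0$ the morphism induced by $E_{[m]}$ is compatible with Frobenius: $$\phi\circ\iota_m\circ\kappa_m=\iota_{m-1}\circ\kappa_{m-1}\circ X(E_{[m]}).$$ Moreover there is exactly one morphism $\Phi_{[m]}:N^{[m]n}X\to N^{[m-1]n}X$ over $\phi:S\to S$ (that is, a natural family of maps $N^{[m]n}X(B)\to N^{[m-1]n}X(B^\phi)$) such that $$\Phi_{[m]}\circ\kappa_m=\kappa_{m-1}\circ X(E_{[m]})\qquad\text{and}\qquad \phi\circ\iota_m=\iota_{m-1}\circ\Phi_{[m]}.$$ -/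

import Mathlib

open CategoryTheory AlgebraicGeometry

universe v u

namespace PiJet

/-- The properties of a uniformizer `π` of a discrete valuation ring `Λ` with residue field of
cardinality `q` on which the theory of `π`-typical Witt vectors rests. -/
structure FrobBase {Λ : Type v} [CommRing Λ] (π : Λ) (q : ℕ) : Prop where
  regular : π ∈ nonZeroDivisors Λ
  primePow : ∃ p k : ℕ, p.Prime ∧ 0 < k ∧ q = p ^ k ∧ (p : Λ) ∈ Ideal.span {π}
  frob : ∀ a : Λ, a ^ q - a ∈ Ideal.span {π}

/-- The `i`-th Witt polynomial
`w_i = x_0 ^ (q ^ i) + π x_1 ^ (q ^ (i - 1)) + ⋯ + π ^ i x_i`. -/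
def ghost {Λ : Type v} [CommRing Λ] (π : Λ) (q : ℕ) {n : ℕ} {B : Type*} [CommRing B] [Algebra Λ B]
    (x : Fin (n + 1) → B) (i : Fin (n + 1)) : B :=
  ∑ j ∈ Finset.Iic i, algebraMap Λ B π ^ (j : ℕ) * x j ^ q ^ ((i : ℕ) - (j : ℕ))

section Dwork

variable {Λ : Type v} [CommRing Λ] {π : Λ} {q : ℕ}

theorem FrobBase.q_dvd (h : FrobBase π q) : π ∣ (q : Λ) := by
  obtain ⟨p, k, -, hk, rfl, hp⟩ := h.primePow
  rw [Ideal.mem_span_singleton] at hp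
  push_cast
  exact hp.trans (dvd_pow_self _ hk.ne')

theorem FrobBase.q_ne_zero (h : FrobBase π q) : q ≠ 0 := by
  obtain ⟨p, k, hp, -, rfl, -⟩ := h.primePow
  exact pow_ne_zero _ hp.ne_zero

theorem dvd_pow_sub_pow {A : Type*} [CommRing A] {t a b : A} (hq : t ∣ (q : A)) {j : ℕ}
    (hab : t ^ (j + 1) ∣ a - b) : t ^ (j + 2) ∣ a ^ q - b ^ q := by
  obtain ⟨c, hc⟩ := hab
  obtain ⟨e, he⟩ := hq
  obtain ⟨k, hk⟩ := Polynomial.powAddExpansion b (t ^ (j + 1) * c) q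
  have : a = b + t ^ (j + 1) * c := by rw [← hc]; ring
  rw [this, hk, he]
  exact ⟨e * b ^ (q - 1) * c + k * t ^ j * c ^ 2, by ring⟩

theorem dvd_iterate_pow_sub {A : Type*} [CommRing A] {t a b : A} (hq : t ∣ (q : A))
    (hab : t ∣ a - b ^ q) (i : ℕ) : t ^ (i + 1) ∣ a ^ q ^ i - b ^ q ^ (i + 1) := by
  induction i with
  | zero => simpa using hab
  | succ i ih =>
    have := dvd_pow_sub_pow hq ih
    rwa [← pow_mul, ← pow_mul, ← pow_succ, ← pow_succ] at this

/-- A sequence satisfying Dwork's congruences is a sequence of ghost components. -/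
theorem exists_of_congr {A : Type*} [CommRing A] {t : A} (hq : t ∣ (q : A)) (σ : A →+* A)
    (hσt : σ t = t) (hσ : ∀ a, t ∣ σ a - a ^ q) (w : ℕ → A) (n : ℕ)
    (hw : ∀ i < n, t ^ (i + 1) ∣ σ (w i) - w (i + 1)) :
    ∃ x : ℕ → A, ∀ i ≤ n, ∑ j ∈ Finset.range (i + 1), t ^ j * x j ^ q ^ (i - j) = w i := by
  induction n with
  | zero => exact ⟨w, fun i hi => by obtain rfl : i = 0 := by omega
                                     simp⟩
  | succ n ih =>
    obtain ⟨x, hx⟩ := ih fun i hi => hw i (by omega)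
    have h1 : t ^ (n + 1) ∣ σ (w n) - ∑ j ∈ Finset.range (n + 1), t ^ j * x j ^ q ^ (n + 1 - j) := by
      rw [← hx n le_rfl, map_sum, ← Finset.sum_sub_distrib]
      refine Finset.dvd_sum fun j hj => ?_
      rw [Finset.mem_range] at hj
      have := dvd_iterate_pow_sub hq (hσ (x j)) (n - j)
      rw [map_mul, map_pow, map_pow, hσt, ← mul_sub,
        show n + 1 - j = n - j + 1 by omega]
      calc t ^ (n + 1) = t ^ j * t ^ (n - j + 1) := by rw [← pow_add]; congr 1; omega
        _ ∣ _ := mul_dvd_mul_left _ this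
    have h2 := dvd_sub h1 (hw n (by omega))
    obtain ⟨c, hc⟩ := h2
    refine ⟨fun j => if j ≤ n then x j else c, fun i hi => ?_⟩
    have key : ∀ k ≤ n + 1, ∀ i, ∑ j ∈ Finset.range k,
        t ^ j * (if j ≤ n then x j else c) ^ q ^ (i - j) =
        ∑ j ∈ Finset.range k, t ^ j * x j ^ q ^ (i - j) := fun k hk i =>
      Finset.sum_congr rfl fun j hj => by
        rw [Finset.mem_range] at hj
        rw [if_pos (by omega)]
    rcases Nat.lt_or_ge i (n + 1) with hi' | hi'
    · rw [key _ (by omega), hx i (by omega)]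
    · obtain rfl : i = n + 1 := by omega
      rw [Finset.sum_range_succ, key _ le_rfl]
      simp only [Nat.sub_self, pow_zero, pow_one, show ¬ n + 1 ≤ n by omega, if_false]
      rw [← hc]
      ring

theorem sum_congr_of_dvd {A : Type*} [CommRing A] {t : A} (hq : t ∣ (q : A)) (σ : A →+* A)
    (hσt : σ t = t) (hσ : ∀ a, t ∣ σ a - a ^ q) (x : ℕ → A) (i : ℕ) :
    t ^ (i + 1) ∣ σ (∑ j ∈ Finset.range (i + 1), t ^ j * x j ^ q ^ (i - j)) -
      ∑ j ∈ Finset.range (i + 1 + 1), t ^ j * x j ^ q ^ (i + 1 - j) := by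
  rw [Finset.sum_range_succ _ (i + 1), ← sub_sub]
  refine dvd_sub ?_ (Dvd.intro _ rfl)
  rw [map_sum, ← Finset.sum_sub_distrib]
  refine Finset.dvd_sum fun j hj => ?_
  rw [Finset.mem_range] at hj
  have := dvd_iterate_pow_sub hq (hσ (x j)) (i - j)
  rw [map_mul, map_pow, map_pow, hσt, ← mul_sub, show i + 1 - j = i - j + 1 by omega]
  calc t ^ (i + 1) = t ^ j * t ^ (i - j + 1) := by rw [← pow_add]; congr 1; omega
    _ ∣ _ := mul_dvd_mul_left _ this

theorem ghost_eq_sum_range {B : Type*} [CommRing B] [Algebra Λ B] {n : ℕ} (x : ℕ → B)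
    (i : Fin (n + 1)) : ghost π q (fun j : Fin (n + 1) => x j) i =
      ∑ j ∈ Finset.range (i + 1), algebraMap Λ B π ^ j * x j ^ q ^ ((i : ℕ) - j) := by
  have : Finset.range ((i : ℕ) + 1) = (Finset.Iic i).map Fin.valEmbedding := by
    rw [Fin.map_valEmbedding_Iic]
    ext; simp
  rw [this, Finset.sum_map]
  rfl

/-- Extension of a vector by zero to an infinite sequence. -/
def extend {B : Type*} [Zero B] {n : ℕ} (x : Fin (n + 1) → B) (j : ℕ) : B :=
  if h : j < n + 1 then x ⟨j, h⟩ else 0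

theorem extend_val {B : Type*} [Zero B] {n : ℕ} (x : Fin (n + 1) → B) :
    (fun j : Fin (n + 1) => extend x j) = x := by
  ext j; simp only [extend, dif_pos j.2]

/-- Dwork's lemma for truncated Witt vectors. -/
theorem exists_ghost_eq (h : FrobBase π q) {A : Type*} [CommRing A] [Algebra Λ A] (σ : A →ₐ[Λ] A)
    (hσ : ∀ a, algebraMap Λ A π ∣ σ a - a ^ q) {n : ℕ} (w : ℕ → A)
    (hw : ∀ i < n, algebraMap Λ A π ^ (i + 1) ∣ σ (w i) - w (i + 1)) :
    ∃ x : Fin (n + 1) → A, ∀ i, ghost π q x i = w i := by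
  have hq : algebraMap Λ A π ∣ (q : A) := by
    simpa using (algebraMap Λ A).map_dvd h.q_dvd
  obtain ⟨x, hx⟩ := exists_of_congr hq σ.toRingHom (by simp) hσ w n hw
  exact ⟨fun j => x j, fun i => by rw [ghost_eq_sum_range, hx i (by omega)]⟩

theorem ghost_congr (h : FrobBase π q) {A : Type*} [CommRing A] [Algebra Λ A] (σ : A →ₐ[Λ] A)
    (hσ : ∀ a, algebraMap Λ A π ∣ σ a - a ^ q) {n : ℕ} (x : Fin (n + 1) → A) (i : ℕ) (hi : i < n) :
    algebraMap Λ A π ^ (i + 1) ∣ σ (ghost π q x ⟨i, by omega⟩) - ghost π q x ⟨i + 1, by omega⟩ := by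
  have hq : algebraMap Λ A π ∣ (q : A) := by
    simpa using (algebraMap Λ A).map_dvd h.q_dvd
  have := sum_congr_of_dvd hq σ.toRingHom (by simp) hσ (extend x) i
  rw [← extend_val x, ghost_eq_sum_range, ghost_eq_sum_range]
  exact this

theorem ghost_injective {A : Type*} [CommRing A] [Algebra Λ A]
    (hA : algebraMap Λ A π ∈ nonZeroDivisors A) {n : ℕ} {x y : Fin (n + 1) → A}
    (hxy : ∀ i, ghost π q x i = ghost π q y i) : x = y := by
  have : ∀ k : ℕ, ∀ hk : k < n + 1, x ⟨k, hk⟩ = y ⟨k, hk⟩ := by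
    intro k
    induction k using Nat.strong_induction_on with
    | _ k ih =>
      intro hk
      have := hxy ⟨k, hk⟩
      have e : Finset.Iic (⟨k, hk⟩ : Fin (n + 1)) = insert ⟨k, hk⟩ (Finset.Iio ⟨k, hk⟩) := by
        rw [Finset.Iio_insert]
      have e2 : ∑ j ∈ Finset.Iio (⟨k, hk⟩ : Fin (n + 1)),
            algebraMap Λ A π ^ (j : ℕ) * x j ^ q ^ (k - (j : ℕ)) =
          ∑ j ∈ Finset.Iio (⟨k, hk⟩ : Fin (n + 1)),
            algebraMap Λ A π ^ (j : ℕ) * y j ^ q ^ (k - (j : ℕ)) :=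
        Finset.sum_congr rfl fun j hj => by
          have hj' : j < ⟨k, hk⟩ := Finset.mem_Iio.1 hj
          rw [show x j = y j from ih j hj' j.2]
      rw [ghost, ghost, e, Finset.sum_insert (by simp), Finset.sum_insert (by simp), e2] at this
      have := add_right_cancel this
      simp only [Nat.sub_self, pow_zero, pow_one] at this
      have h2 := (pow_mem hA k)
      exact (mul_cancel_left_mem_nonZeroDivisors h2).1 this
  ext ⟨k, hk⟩
  exact this k hk

theorem map_ghost {A B : Type*} [CommRing A] [Algebra Λ A] [CommRing B] [Algebra Λ B]
    (f : A →ₐ[Λ] B) {n : ℕ} (x : Fin (n + 1) → A) (i : Fin (n + 1)) :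
    f (ghost π q x i) = ghost π q (fun j => f (x j)) i := by
  simp [ghost]

/-- The `Λ`-linear endomorphism `X ↦ X ^ q` of a polynomial ring is a lift of Frobenius. -/
theorem dvd_expand_sub (h : FrobBase π q) {τ : Type*} (f : MvPolynomial τ Λ) :
    algebraMap Λ (MvPolynomial τ Λ) π ∣ MvPolynomial.expand q f - f ^ q := by
  obtain ⟨p, k, hp, hk, hq, hpπ⟩ := h.primePow
  have hp' : algebraMap Λ (MvPolynomial τ Λ) π ∣ (p : MvPolynomial τ Λ) := by
    simpa using (algebraMap Λ (MvPolynomial τ Λ)).map_dvd (Ideal.mem_span_singleton.1 hpπ)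
  induction f using MvPolynomial.induction_on with
  | C a =>
    rw [MvPolynomial.expand_C, ← map_pow, ← map_sub, MvPolynomial.algebraMap_eq]
    refine (MvPolynomial.C (σ := τ)).map_dvd ?_
    rw [← neg_sub, dvd_neg]
    exact Ideal.mem_span_singleton.1 (h.frob a)
  | add f g hf hg =>
    obtain ⟨r, hr⟩ := exists_add_pow_prime_pow_eq hp f g k
    rw [map_add]
    nth_rewrite 3 [hq]
    rw [hr, ← hq]
    have := dvd_sub (dvd_add hf hg) (hp'.mul_right (f * g * r))
    convert this using 1
    ring
  | mul_X f i hf =>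
    rw [map_mul, MvPolynomial.expand_X, mul_pow, ← sub_mul]
    exact hf.mul_right _

theorem regular_mvPolynomial (h : FrobBase π q) (τ : Type*) :
    algebraMap Λ (MvPolynomial τ Λ) π ∈ nonZeroDivisors (MvPolynomial τ Λ) := by
  rw [mem_nonZeroDivisors_iff_right]
  intro f hf
  ext d
  have := congrArg (MvPolynomial.coeff d) hf
  rw [mul_comm, MvPolynomial.algebraMap_eq, MvPolynomial.coeff_C_mul, MvPolynomial.coeff_zero,
    mul_comm] at this
  simpa using (mem_nonZeroDivisors_iff_right.1 h.regular) _ this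

/-- For every polynomial operation `Φ` there are polynomials in the coordinates of the arguments
whose ghost components are obtained by applying `Φ` to the ghost components of the arguments. -/
theorem exists_structPoly (h : FrobBase π q) (n : ℕ) {ι : Type} (Φ : MvPolynomial ι Λ) :
    ∃ s : Fin (n + 1) → MvPolynomial (ι × Fin (n + 1)) Λ, ∀ i,
      ghost π q s i =
        MvPolynomial.aeval (fun a : ι => ghost π q (fun j => MvPolynomial.X (a, j)) i) Φ := by
  let w : ℕ → MvPolynomial (ι × Fin (n + 1)) Λ := fun k =>
    if hk : k < n + 1 then
      MvPolynomial.aeval (fun a : ι => ghost π q (fun j => MvPolynomial.X (a, j)) ⟨k, hk⟩) Φ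
    else 0
  obtain ⟨x, hx⟩ := exists_ghost_eq h (MvPolynomial.expand q) (dvd_expand_sub h) (n := n) w (by
    intro i hi
    have h1 : i < n + 1 := by omega
    have h2 : i + 1 < n + 1 := by omega
    simp only [w, dif_pos h1, dif_pos h2]
    rw [← Ideal.mem_span_singleton, ← Ideal.Quotient.eq, ← Ideal.Quotient.mkₐ_eq_mk Λ,
      ← AlgHom.comp_apply, ← AlgHom.comp_apply, ← AlgHom.comp_apply]
    congr 1
    ext a
    simp only [AlgHom.comp_apply, MvPolynomial.aeval_X]
    rw [Ideal.Quotient.mkₐ_eq_mk, Ideal.Quotient.eq, Ideal.mem_span_singleton]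
    exact ghost_congr h _ (dvd_expand_sub h) _ i hi)
  exact ⟨x, fun i => by rw [hx i]; simp only [w, dif_pos i.2]⟩

/-- The polynomials giving the coordinates of the Frobenius: their ghost components are the ghost
components of the argument, shifted by one. -/
theorem exists_frobPoly (h : FrobBase π q) (n : ℕ) :
    ∃ s : Fin (n + 1) → MvPolynomial (Fin (n + 2)) Λ, ∀ i,
      ghost π q s i = ghost π q MvPolynomial.X i.succ := by
  let w : ℕ → MvPolynomial (Fin (n + 2)) Λ := fun k =>
    if hk : k < n + 1 then ghost π q MvPolynomial.X ⟨k + 1, by omega⟩ else 0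
  obtain ⟨x, hx⟩ := exists_ghost_eq h (MvPolynomial.expand q) (dvd_expand_sub h) (n := n) w (by
    intro i hi
    have h1 : i < n + 1 := by omega
    have h2 : i + 1 < n + 1 := by omega
    simp only [w, dif_pos h1, dif_pos h2]
    exact (pow_dvd_pow _ (by omega)).trans
      (ghost_congr h _ (dvd_expand_sub h) (MvPolynomial.X) (i + 1) (by omega)))
  exact ⟨x, fun i => by rw [hx i]; simp only [w, dif_pos i.2]; rfl⟩

end Dwork


/-- The `π`-typical Witt vectors of length `n + 1` over `B`; as a set this is `B ^ (n + 1)`. -/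
@[ext]
structure Witt {Λ : Type v} [CommRing Λ] {π : Λ} {q : ℕ} (h : FrobBase π q) (n : ℕ)
    (B : Type*) where
  coeff : Fin (n + 1) → B

namespace Witt

section Ring

variable {Λ : Type v} [CommRing Λ] {π : Λ} {q : ℕ} {h : FrobBase π q} {n : ℕ}
variable {A B : Type*} [CommRing A] [Algebra Λ A] [CommRing B] [Algebra Λ B]

/-- The `i`-th ghost component of a Witt vector. -/
def gh (x : Witt h n B) (i : Fin (n + 1)) : B := ghost π q x.coeff i

/-- The operation on Witt vectors which is `Φ` on ghost components, for all `Λ`-algebras. -/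
noncomputable def op {ι : Type} (Φ : MvPolynomial ι Λ) (x : ι → Witt h n B) : Witt h n B :=
  ⟨fun i => MvPolynomial.aeval (fun a : ι × Fin (n + 1) => (x a.1).coeff a.2)
    ((exists_structPoly h n Φ).choose i)⟩

theorem gh_op {ι : Type} (Φ : MvPolynomial ι Λ) (x : ι → Witt h n B) (i : Fin (n + 1)) :
    (op Φ x).gh i = MvPolynomial.aeval (fun a => (x a).gh i) Φ := by
  have := congrArg (MvPolynomial.aeval (fun a : ι × Fin (n + 1) => (x a.1).coeff a.2))
    ((exists_structPoly h n Φ).choose_spec i)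
  rw [map_ghost] at this
  rw [gh, op, this, ← AlgHom.comp_apply]
  congr 1
  ext a
  simp [map_ghost, gh]

/-- The map on Witt vectors induced by a map on coefficients. -/
def mapFun (f : A → B) (x : Witt h n A) : Witt h n B := ⟨fun i => f (x.coeff i)⟩

theorem mapFun_op (f : A →ₐ[Λ] B) {ι : Type} (Φ : MvPolynomial ι Λ) (x : ι → Witt h n A) :
    mapFun f (op Φ x) = op Φ (fun a => mapFun f (x a)) := by
  ext i
  simp only [mapFun, op, ← AlgHom.comp_apply]
  congr 1
  ext a
  simp

noncomputable instance : Zero (Witt h n B) := ⟨op (0 : MvPolynomial Empty Λ) Empty.elim⟩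
noncomputable instance : One (Witt h n B) := ⟨op (1 : MvPolynomial Empty Λ) Empty.elim⟩
noncomputable instance : Add (Witt h n B) :=
  ⟨fun x y => op (.X 0 + .X 1 : MvPolynomial (Fin 2) Λ) ![x, y]⟩
noncomputable instance : Mul (Witt h n B) :=
  ⟨fun x y => op (.X 0 * .X 1 : MvPolynomial (Fin 2) Λ) ![x, y]⟩
noncomputable instance : Neg (Witt h n B) := ⟨fun x => op (-.X () : MvPolynomial Unit Λ) fun _ => x⟩
noncomputable instance : Sub (Witt h n B) :=
  ⟨fun x y => op (.X 0 - .X 1 : MvPolynomial (Fin 2) Λ) ![x, y]⟩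
noncomputable instance : SMul ℕ (Witt h n B) :=
  ⟨fun k x => op (k • .X () : MvPolynomial Unit Λ) fun _ => x⟩
noncomputable instance : SMul ℤ (Witt h n B) :=
  ⟨fun k x => op (k • .X () : MvPolynomial Unit Λ) fun _ => x⟩
noncomputable instance : Pow (Witt h n B) ℕ :=
  ⟨fun x k => op (.X () ^ k : MvPolynomial Unit Λ) fun _ => x⟩
noncomputable instance : NatCast (Witt h n B) :=
  ⟨fun k => op (k : MvPolynomial Empty Λ) Empty.elim⟩
noncomputable instance : IntCast (Witt h n B) :=
  ⟨fun k => op (k : MvPolynomial Empty Λ) Empty.elim⟩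

theorem gh_injective (hA : algebraMap Λ A π ∈ nonZeroDivisors A) :
    Function.Injective (gh : Witt h n A → Fin (n + 1) → A) := fun x y hxy => by
  ext1; exact ghost_injective hA fun i => congrFun hxy i

/-- The ring of Witt vectors over an algebra without `π`-torsion. -/
noncomputable abbrev commRingAux (hA : algebraMap Λ A π ∈ nonZeroDivisors A) :
    CommRing (Witt h n A) := by
  refine Function.Injective.commRing gh (gh_injective hA) ?_ ?_ ?_ ?_ ?_ ?_ ?_ ?_ ?_ ?_ ?_
  · ext i; exact (gh_op _ _ i).trans (by simp)
  · ext i; exact (gh_op _ _ i).trans (by simp)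
  · intro x y; ext i; exact (gh_op _ _ i).trans (by simp)
  · intro x y; ext i; exact (gh_op _ _ i).trans (by simp)
  · intro x; ext i; exact (gh_op _ _ i).trans (by simp)
  · intro x y; ext i; exact (gh_op _ _ i).trans (by simp)
  · intro k x; ext i; exact (gh_op _ _ i).trans (by simp)
  · intro k x; ext i; exact (gh_op _ _ i).trans (by simp)
  · intro x k; ext i; exact (gh_op _ _ i).trans (by simp)
  · intro k; ext i; exact (gh_op _ _ i).trans (by simp)
  · intro k; ext i; exact (gh_op _ _ i).trans (by simp)

theorem mapFun_op' (f : A →ₐ[Λ] B) {ι : Type} (Φ : MvPolynomial ι Λ) (x : ι → Witt h n A)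
    (y : ι → Witt h n B) (hxy : ∀ a, mapFun f (x a) = y a) :
    mapFun f (op Φ x) = op Φ y := by
  rw [mapFun_op]; congr 1; ext1 a; exact hxy a

/-- The presentation of an algebra as a quotient of a polynomial ring. -/
noncomputable def pres (Λ : Type v) [CommRing Λ] (B : Type*) [CommRing B] [Algebra Λ B] :
    MvPolynomial B Λ →ₐ[Λ] B := MvPolynomial.aeval id

theorem mapFun_pres_surjective :
    Function.Surjective (mapFun (pres Λ B) : Witt h n (MvPolynomial B Λ) → Witt h n B) :=
  fun x => ⟨⟨fun i => .X (x.coeff i)⟩, by ext i; simp [mapFun, pres]⟩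

noncomputable instance : CommRing (Witt h n B) := by
  letI := commRingAux (h := h) (n := n) (regular_mvPolynomial h B)
  refine Function.Surjective.commRing (mapFun (pres Λ B)) mapFun_pres_surjective
    ?_ ?_ ?_ ?_ ?_ ?_ ?_ ?_ ?_ ?_ ?_
  · exact mapFun_op' _ _ _ _ (by simp)
  · exact mapFun_op' _ _ _ _ (by simp)
  · intro x y; exact mapFun_op' _ _ _ _ (by simp [Fin.forall_fin_two])
  · intro x y; exact mapFun_op' _ _ _ _ (by simp [Fin.forall_fin_two])
  · intro x; exact mapFun_op' _ _ _ _ (by simp)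
  · intro x y; exact mapFun_op' _ _ _ _ (by simp [Fin.forall_fin_two])
  · intro k x; exact mapFun_op' _ _ _ _ (by simp)
  · intro k x; exact mapFun_op' _ _ _ _ (by simp)
  · intro x k; exact mapFun_op' _ _ _ _ (by simp)
  · intro k; exact mapFun_op' _ _ _ _ (by simp)
  · intro k; exact mapFun_op' _ _ _ _ (by simp)

theorem gh_zero (i : Fin (n + 1)) : (0 : Witt h n B).gh i = 0 := (gh_op _ _ i).trans (by simp)
theorem gh_one (i : Fin (n + 1)) : (1 : Witt h n B).gh i = 1 := (gh_op _ _ i).trans (by simp)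
theorem gh_add (x y : Witt h n B) (i : Fin (n + 1)) : (x + y).gh i = x.gh i + y.gh i :=
  (gh_op _ _ i).trans (by simp)
theorem gh_mul (x y : Witt h n B) (i : Fin (n + 1)) : (x * y).gh i = x.gh i * y.gh i :=
  (gh_op _ _ i).trans (by simp)

/-- The constant Witt vectors, with all ghost components equal to `a ∈ Λ`, make the Witt vectors
a `Λ`-algebra. -/
noncomputable def const (a : Λ) : Witt h n B :=
  op (MvPolynomial.C a : MvPolynomial Empty Λ) Empty.elim

theorem gh_const (a : Λ) (i : Fin (n + 1)) :
    (const a : Witt h n B).gh i = algebraMap Λ B a :=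
  (gh_op _ _ i).trans (by simp)

theorem mapFun_const (f : A →ₐ[Λ] B) (a : Λ) :
    mapFun f (const a : Witt h n A) = const a := mapFun_op' _ _ _ _ (by simp)
theorem mapFun_one (f : A →ₐ[Λ] B) : mapFun f (1 : Witt h n A) = 1 := mapFun_op' _ _ _ _ (by simp)
theorem mapFun_zero (f : A →ₐ[Λ] B) : mapFun f (0 : Witt h n A) = 0 := mapFun_op' _ _ _ _ (by simp)
theorem mapFun_add (f : A →ₐ[Λ] B) (x y : Witt h n A) :
    mapFun f (x + y) = mapFun f x + mapFun f y :=
  mapFun_op' _ _ _ _ (by simp [Fin.forall_fin_two])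
theorem mapFun_mul (f : A →ₐ[Λ] B) (x y : Witt h n A) :
    mapFun f (x * y) = mapFun f x * mapFun f y :=
  mapFun_op' _ _ _ _ (by simp [Fin.forall_fin_two])

theorem const_hom : (const (1 : Λ) : Witt h n B) = 1 ∧ (const (0 : Λ) : Witt h n B) = 0 ∧
    (∀ a b : Λ, (const (a + b) : Witt h n B) = const a + const b) ∧
    (∀ a b : Λ, (const (a * b) : Witt h n B) = const a * const b) := by
  have inj := gh_injective (h := h) (n := n) (regular_mvPolynomial h B)
  refine ⟨?_, ?_, fun a b => ?_, fun a b => ?_⟩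
  · rw [← mapFun_const (pres Λ B), ← mapFun_one (pres Λ B)]
    refine congrArg _ (inj ?_); ext1 i; simp only [gh_const, gh_one, map_one]
  · rw [← mapFun_const (pres Λ B), ← mapFun_zero (pres Λ B)]
    refine congrArg _ (inj ?_); ext1 i; simp only [gh_const, gh_zero, map_zero]
  · simp only [← mapFun_const (pres Λ B), ← mapFun_add (pres Λ B)]
    refine congrArg _ (inj ?_); ext1 i; simp only [gh_const, gh_add, map_add]
  · simp only [← mapFun_const (pres Λ B), ← mapFun_mul (pres Λ B)]
    refine congrArg _ (inj ?_); ext1 i; simp only [gh_const, gh_mul, map_mul]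

noncomputable instance : Algebra Λ (Witt h n B) :=
  RingHom.toAlgebra
    { toFun := const
      map_one' := const_hom.1
      map_zero' := const_hom.2.1
      map_add' := const_hom.2.2.1
      map_mul' := const_hom.2.2.2 }

theorem gh_algebraMap (a : Λ) (i : Fin (n + 1)) :
    (algebraMap Λ (Witt h n B) a).gh i = algebraMap Λ B a := gh_const a i

/-- Functoriality of the Witt vectors. -/
noncomputable def map (f : A →ₐ[Λ] B) : Witt h n A →ₐ[Λ] Witt h n B where
  toFun := mapFun f
  map_one' := mapFun_one f
  map_zero' := mapFun_zero f
  map_add' := mapFun_add f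
  map_mul' := mapFun_mul f
  commutes' := mapFun_const f

/-- A natural map of Witt vectors which has a description on ghost components by a selection of
components is a homomorphism of algebras. -/
theorem hom_of_gh {k : ℕ} (r : Fin (k + 1) → Fin (n + 1))
    (G : Witt h n (MvPolynomial B Λ) → Witt h k (MvPolynomial B Λ))
    (hG : ∀ x i, (G x).gh i = x.gh (r i)) (G' : Witt h n B → Witt h k B)
    (nat : ∀ x, mapFun (pres Λ B) (G x) = G' (mapFun (pres Λ B) x)) :
    (∀ a : Λ, G' (algebraMap Λ _ a) = algebraMap Λ _ a) ∧
    (∀ x y, G' (x + y) = G' x + G' y) ∧ (∀ x y, G' (x * y) = G' x * G' y) := by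
  have inj := gh_injective (h := h) (n := k) (regular_mvPolynomial h B)
  refine ⟨fun a => ?_, fun x y => ?_, fun x y => ?_⟩
  · change G' (const a) = const a
    rw [← mapFun_const (pres Λ B), ← nat, ← mapFun_const (pres Λ B)]
    refine congrArg _ (inj ?_); ext1 i; rw [hG, gh_const, gh_const]
  · obtain ⟨x, rfl⟩ := mapFun_pres_surjective x
    obtain ⟨y, rfl⟩ := mapFun_pres_surjective y
    rw [← mapFun_add, ← nat, ← nat, ← nat, ← mapFun_add]
    refine congrArg _ (inj ?_); ext1 i; simp only [hG, gh_add]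
  · obtain ⟨x, rfl⟩ := mapFun_pres_surjective x
    obtain ⟨y, rfl⟩ := mapFun_pres_surjective y
    rw [← mapFun_mul, ← nat, ← nat, ← nat, ← mapFun_mul]
    refine congrArg _ (inj ?_); ext1 i; simp only [hG, gh_mul]

/-- An algebra homomorphism from a map that preserves constants, sums and products. -/
def mkHom {S T : Type*} [CommRing S] [Algebra Λ S] [CommRing T] [Algebra Λ T] (G : S → T)
    (hG : (∀ a : Λ, G (algebraMap Λ _ a) = algebraMap Λ _ a) ∧
      (∀ x y, G (x + y) = G x + G y) ∧ (∀ x y, G (x * y) = G x * G y)) : S →ₐ[Λ] T where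
  toFun := G
  map_one' := by simpa using hG.1 1
  map_zero' := by simpa using hG.1 0
  map_add' := hG.2.1
  map_mul' := hG.2.2
  commutes' := hG.1

/-- The restriction of a Witt vector to its first `k + 1` coordinates. -/
def truncFun {k n : ℕ} {B : Type*} (hk : k ≤ n) (x : Witt h n B) : Witt h k B :=
  ⟨fun i => x.coeff (Fin.castLE (by omega) i)⟩

theorem gh_truncFun {k n : ℕ} (hk : k ≤ n) (x : Witt h n B) (i : Fin (k + 1)) :
    (truncFun hk x).gh i = x.gh (Fin.castLE (by omega) i) := by
  unfold gh
  rw [← extend_val x.coeff, ghost_eq_sum_range]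
  refine Eq.trans ?_ (ghost_eq_sum_range (Λ := Λ) (n := k) (extend x.coeff) i)
  congr 1
  ext j
  simp only [truncFun, extend]
  rw [dif_pos (by omega)]
  rfl

/-- The restriction homomorphism `T` on Witt vectors (iterated if `k < n - 1`). -/
noncomputable def trunc {k n : ℕ} (hk : k ≤ n) : Witt h n B →ₐ[Λ] Witt h k B :=
  mkHom (truncFun hk) (hom_of_gh _ (truncFun hk) (gh_truncFun hk) _ fun _ => rfl)

/-- The Frobenius on Witt vectors, given by the universal Frobenius polynomials. -/
noncomputable def frobFun (x : Witt h (n + 1) B) : Witt h n B :=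
  ⟨fun i => MvPolynomial.aeval x.coeff ((exists_frobPoly h n).choose i)⟩

theorem gh_frobFun (x : Witt h (n + 1) B) (i : Fin (n + 1)) :
    (frobFun x).gh i = x.gh i.succ := by
  have := congrArg (MvPolynomial.aeval (R := Λ) x.coeff) ((exists_frobPoly h n).choose_spec i)
  rw [map_ghost, map_ghost] at this
  simpa [gh, frobFun] using this

theorem mapFun_frobFun (f : A →ₐ[Λ] B) (x : Witt h (n + 1) A) :
    mapFun f (frobFun x) = frobFun (mapFun f x) := by
  ext i
  simp only [mapFun, frobFun, ← AlgHom.comp_apply]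
  congr 1
  ext a
  simp

/-- The Frobenius homomorphism `F` on Witt vectors. -/
noncomputable def frob : Witt h (n + 1) B →ₐ[Λ] Witt h n B :=
  mkHom frobFun (hom_of_gh _ frobFun gh_frobFun _ (mapFun_frobFun _))

theorem map_frob (f : A →ₐ[Λ] B) (x : Witt h (n + 1) A) :
    map f (frob x) = frob (map f x) := mapFun_frobFun f x

theorem gh_map (f : A →ₐ[Λ] B) (x : Witt h n A) (i : Fin (n + 1)) :
    (map f x).gh i = f (x.gh i) := (map_ghost f _ _).symm

theorem gh_frob (x : Witt h (n + 1) B) (i : Fin (n + 1)) : (frob x).gh i = x.gh i.succ :=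
  gh_frobFun x i

theorem gh_trunc {k n : ℕ} (hk : k ≤ n) (x : Witt h n B) (i : Fin (k + 1)) :
    (trunc hk x).gh i = x.gh (Fin.castLE (by omega) i) := gh_truncFun hk x i

theorem trunc_frob {k n : ℕ} (hk : k ≤ n) (hk' : k + 1 ≤ n + 1) (x : Witt h (n + 1) B) :
    trunc hk (frob x) = frob (trunc hk' x) := by
  obtain ⟨x, rfl⟩ := mapFun_pres_surjective x
  change trunc hk (frob (map (pres Λ B) x)) = frob (trunc hk' (map (pres Λ B) x))
  rw [← map_frob]
  change map (pres Λ B) (trunc hk (frob x)) = frob (map (pres Λ B) (trunc hk' x))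
  rw [← map_frob]
  refine congrArg _ (gh_injective (regular_mvPolynomial h B) ?_)
  ext1 i
  simp only [gh_frob, gh_trunc]
  rfl

end Ring

end Witt

/-- A `π`-torsion free `Λ`-algebra `R` with a `Λ`-linear lift `φ` of the `q`-power Frobenius modulo
`π`; equivalently, with a `π`-derivation `δ`, where `φ(x) = x ^ q + π δ(x)`. -/
structure DeltaRing {Λ : Type v} [CommRing Λ] {π : Λ} {q : ℕ} (h : FrobBase π q) (R : Type u)
    [CommRing R] [Algebra Λ R] where
  φ : R →ₐ[Λ] R
  frob : ∀ x, φ x - x ^ q ∈ Ideal.span {algebraMap Λ R π}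
  regular : algebraMap Λ R π ∈ nonZeroDivisors R

namespace DeltaRing

variable {Λ : Type v} [CommRing Λ] {π : Λ} {q : ℕ} {h : FrobBase π q} {R : Type u} [CommRing R]
  [Algebra Λ R] (D : DeltaRing h R)

theorem exists_exp (n : ℕ) (r : R) :
    ∃ x : Witt h n R, ∀ i, x.gh i = (D.φ ^ (i : ℕ)) r := by
  obtain ⟨x, hx⟩ := exists_ghost_eq h D.φ (fun a => Ideal.mem_span_singleton.1 (D.frob a))
    (n := n) (fun i => (D.φ ^ i) r) (fun i _ => by
      rw [pow_succ' D.φ, AlgHom.mul_apply, sub_self]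
      exact dvd_zero _)
  exact ⟨⟨x⟩, hx⟩

/-- The universal map `exp_δ : R → W_n(R)`, with ghost components `r, φ(r), …, φ ^ n (r)`. -/
noncomputable def exp (n : ℕ) : R →ₐ[Λ] Witt h n R :=
  Witt.mkHom (fun r => (D.exists_exp n r).choose) (by
    have inj := Witt.gh_injective (h := h) (n := n) D.regular
    have key := fun r => (D.exists_exp n r).choose_spec
    refine ⟨fun a => inj ?_, fun x y => inj ?_, fun x y => inj ?_⟩ <;> ext1 i
    · rw [key, Witt.gh_algebraMap, AlgHom.commutes]
    · rw [Witt.gh_add, key, key, key, map_add]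
    · rw [Witt.gh_mul, key, key, key, map_mul])

theorem gh_exp (n : ℕ) (r : R) (i : Fin (n + 1)) :
    (D.exp n r).gh i = (D.φ ^ (i : ℕ)) r := (D.exists_exp n r).choose_spec i

theorem trunc_exp {k n : ℕ} (hk : k ≤ n) (r : R) : Witt.trunc hk (D.exp n r) = D.exp k r := by
  apply Witt.gh_injective D.regular
  ext1 i
  rw [Witt.gh_trunc, gh_exp, gh_exp, Fin.val_castLE]

theorem frob_exp (n : ℕ) (r : R) :
    Witt.frob (D.exp (n + 1) r) = Witt.map D.φ (D.exp n r) := by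
  apply Witt.gh_injective D.regular
  ext1 i
  rw [Witt.gh_frob, Witt.gh_map, gh_exp, gh_exp, Fin.val_succ, pow_succ', AlgHom.mul_apply]

end DeltaRing


section Formal

variable {Λ : Type v} [CommRing Λ]

/-- Reduction of a `Λ`-algebra modulo `π ^ (k + 1)`. -/
noncomputable def red (π : Λ) (k : ℕ) : CommAlgCat.{u} Λ ⥤ CommRingCat.{u} where
  obj C := .of (C ⧸ Ideal.span {algebraMap Λ C π ^ (k + 1)})
  map f := CommRingCat.ofHom (Ideal.quotientMap _ f.hom.toRingHom (by
    rw [Ideal.span_singleton_le_iff_mem, Ideal.mem_comap]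
    simp))
  map_id C := by
    ext x
    rfl
  map_comp f g := by
    ext x
    rfl

/-- The projection from the reduction modulo `π ^ (k + 2)` to the reduction modulo
`π ^ (k + 1)`. -/
noncomputable def redTrans (π : Λ) (k : ℕ) : red.{v, u} π (k + 1) ⟶ red π k where
  app C := CommRingCat.ofHom (Ideal.Quotient.factor
    (Ideal.span_singleton_le_span_singleton.2 (pow_dvd_pow _ (Nat.le_succ _))))
  naturality C C' f := by
    apply CommRingCat.hom_ext
    apply Ideal.Quotient.ringHom_ext
    rfl

/-- A `π`-formal scheme `X` over `Spf R`, i.e. a formal scheme over `Spf R` whose topology is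
the `π`-adic one, given by the system of its reductions `X_k = X ×_{Spf R} Spec (R / π ^ (k + 1))`:
schemes `X_k` over `R / π ^ (k + 1)` with isomorphisms
`X_k ≅ X_{k + 1} ×_{Spec (R / π ^ (k + 2))} Spec (R / π ^ (k + 1))`. -/
structure PiFormalScheme (π : Λ) (R : Type u) [CommRing R] [Algebra Λ R] where
  scheme : ℕ → Scheme.{u}
  str (k : ℕ) : scheme k ⟶ Spec ((red π k).obj (.of Λ R))
  trans (k : ℕ) : scheme k ⟶ scheme (k + 1)
  isPullback (k : ℕ) : IsPullback (trans k) (str k) (str (k + 1))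
    (Spec.map ((redTrans π k).app (.of Λ R)))

/-- The category of `R`-algebras (over the base `Λ`). -/
abbrev AlgOver (Λ : Type v) [CommRing Λ] (R : Type u) [CommRing R] [Algebra Λ R] :=
  Under (CommAlgCat.of.{u} Λ R)

/-- `R` as an `R`-algebra. -/
abbrev baseAlg (Λ : Type v) [CommRing Λ] (R : Type u) [CommRing R] [Algebra Λ R] : AlgOver Λ R :=
  Under.mk (𝟙 (CommAlgCat.of Λ R))

/-- The structure map `R → B` of an `R`-algebra `B`. -/
def strMap {R : Type u} [CommRing R] [Algebra Λ R] (B : AlgOver Λ R) : baseAlg Λ R ⟶ B :=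
  Under.homMk B.hom (by simp [baseAlg])

theorem base_hom_ext {R : Type u} [CommRing R] [Algebra Λ R] {B : AlgOver Λ R}
    (f g : baseAlg Λ R ⟶ B) : f = g :=
  Under.mkIdInitial.hom_ext f g

/-- The `π`-adically complete `R`-algebras. -/
def isPiComplete (π : Λ) (R : Type u) [CommRing R] [Algebra Λ R] :
    ObjectProperty (AlgOver Λ R) :=
  fun B => IsAdicComplete (Ideal.span {algebraMap Λ B.right π}) B.right

/-- The functor of points of a `π`-formal scheme over `Spf R`: for an `R`-algebra `C`, the set
`X(C)` of morphisms `Spf C ⟶ X` over `Spf R`, that is, of compatible families of morphisms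
`Spec (C / π ^ (k + 1)) ⟶ X_k` over `Spec (R / π ^ (k + 1))`. -/
noncomputable def PiFormalScheme.points {π : Λ} {R : Type u} [CommRing R] [Algebra Λ R]
    (X : PiFormalScheme π R) : AlgOver Λ R ⥤ Type u where
  obj C := { x : ∀ k : ℕ, Spec ((red π k).obj C.right) ⟶ X.scheme k //
    (∀ k, x k ≫ X.str k = Spec.map ((red π k).map C.hom)) ∧
    ∀ k, x k ≫ X.trans k = Spec.map ((redTrans π k).app C.right) ≫ x (k + 1) }
  map {C C'} f := TypeCat.ofHom fun x => ⟨fun k => Spec.map ((red π k).map f.right) ≫ x.1 k,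
    fun k => by
      rw [Category.assoc, x.2.1, ← Spec.map_comp, ← Functor.map_comp, Under.w f],
    fun k => by
      rw [Category.assoc, x.2.2, ← Category.assoc, ← Category.assoc, ← Spec.map_comp,
        ← Spec.map_comp, (redTrans π k).naturality]⟩
  map_id C := by
    ext x
    simp
  map_comp f g := by
    ext x
    simp

theorem PiFormalScheme.map_comp_apply {π : Λ} {R : Type u} [CommRing R] [Algebra Λ R]
    (X : PiFormalScheme π R) {A B C : AlgOver Λ R} (f : A ⟶ B) (g : B ⟶ C) (x : X.points.obj A) :
    X.points.map (f ≫ g) x = X.points.map g (X.points.map f x) := by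
  rw [Functor.map_comp]
  rfl

end Formal

section Functors

variable {Λ : Type v} [CommRing Λ] {π : Λ} {q : ℕ} {h : FrobBase π q} {R : Type u} [CommRing R]
  [Algebra Λ R] (D : DeltaRing h R)

namespace DeltaRing

/-- The `R`-algebra `W_n(B)` of Witt vectors of length `n + 1`, for `R`-algebras `B`; its structure
map is `R → W_n(R) → W_n(B)`. -/
noncomputable def W (n : ℕ) : AlgOver Λ R ⥤ AlgOver Λ R where
  obj B := Under.mk (CommAlgCat.ofHom ((Witt.map (h := h) (n := n) B.hom.hom).comp (D.exp n)))
  map {B C} f := Under.homMk (CommAlgCat.ofHom (Witt.map f.right.hom)) (by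
    rw [← Under.w f]
    rfl)
  map_id B := rfl
  map_comp f g := rfl

/-- The functor `B ↦ B^φ`, where `B^φ` is the ring `B` with structure map `R → R → B`, the first
map being `φ`. It preserves `π`-adic completeness, since `B^φ` and `B` have the same
`Λ`-structure. -/
def twist : AlgOver Λ R ⥤ AlgOver Λ R := Under.map (CommAlgCat.ofHom D.φ)

/-- The restriction `T : W_n(B) → W_k(B)`, for `k ≤ n`. -/
noncomputable def truncNat {k n : ℕ} (hk : k ≤ n) : D.W n ⟶ D.W k where
  app B := Under.homMk (CommAlgCat.ofHom (Witt.trunc hk)) (by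
    ext r
    change Witt.trunc hk (Witt.map B.hom.hom (D.exp n r)) = Witt.map B.hom.hom (D.exp k r)
    rw [← D.trunc_exp hk]
    rfl)
  naturality B C f := rfl

/-- The Frobenius `F : W_{n + 1}(B) → W_n(B^φ)`. -/
noncomputable def frobNat (n : ℕ) : D.W (n + 1) ⟶ D.twist ⋙ D.W n where
  app B := Under.homMk (CommAlgCat.ofHom Witt.frob) (by
    ext r
    change Witt.frob (Witt.map B.hom.hom (D.exp (n + 1) r)) =
      Witt.map (B.hom.hom.comp D.φ) (D.exp n r)
    rw [← Witt.map_frob, D.frob_exp]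
    rfl)
  naturality B C f := by
    ext x
    exact (Witt.map_frob f.right.hom x).symm

/-- The shifted Witt vectors `W_m(R') ×_{W_m(B)} W_{m + n}(B)` of a homomorphism `R' → B` of
`R`-algebras, as a subalgebra of the product. As a set this is `R' ^ (m + 1) × B ^ n`. -/
noncomputable def shiftedSubalgebra (m n : ℕ) (a : Arrow (AlgOver Λ R)) :
    Subalgebra Λ (((D.W m).obj a.left).right × ((D.W (n + m)).obj a.right).right) :=
  AlgHom.equalizer (((D.W m).map a.hom).right.hom.comp (AlgHom.fst Λ _ _))
    (((D.truncNat (Nat.le_add_left m n)).app a.right).right.hom.comp (AlgHom.snd Λ _ _))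

/-- The functor sending `R' → B` to the `R`-algebra of shifted Witt vectors
`W_m(R') ×_{W_m(B)} W_{m + n}(B)`. -/
noncomputable def shifted (m n : ℕ) : Arrow (AlgOver Λ R) ⥤ AlgOver Λ R where
  obj a := Under.mk (CommAlgCat.ofHom (AlgHom.codRestrict
    (AlgHom.prod ((D.W m).obj a.left).hom.hom ((D.W (n + m)).obj a.right).hom.hom)
    (D.shiftedSubalgebra m n a) (fun r => by
      have h1 := congrArg (fun f => f.hom r) (Under.w ((D.W m).map a.hom))
      have h2 := congrArg (fun f => f.hom r)
        (Under.w ((D.truncNat (Nat.le_add_left m n)).app a.right))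
      exact h1.trans h2.symm)))
  map {a b} f := Under.homMk (CommAlgCat.ofHom (AlgHom.codRestrict
    ((AlgHom.prodMap ((D.W m).map f.left).right.hom ((D.W (n + m)).map f.right).right.hom).comp
      (D.shiftedSubalgebra m n a).val) (D.shiftedSubalgebra m n b) (fun x => by
        have h1 := congrArg (fun g => g.right.hom x.1.1)
          (((D.W m).map_comp f.left b.hom).symm.trans
            ((congrArg (D.W m).map (Arrow.w f)).trans ((D.W m).map_comp a.hom f.right)))
        have h2 := congrArg (fun g => g.right.hom x.1.2)
          ((D.truncNat (Nat.le_add_left m n)).naturality f.right)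
        have h3 := congrArg ((D.W m).map f.right).right.hom x.2
        exact h1.trans (h3.trans h2.symm)))) (by
      ext r
      have h1 := congrArg (fun g => g.hom r) (Under.w ((D.W m).map f.left))
      have h2 := congrArg (fun g => g.hom r) (Under.w ((D.W (n + m)).map f.right))
      exact Subtype.ext (Prod.ext h1 h2))
  map_id a := rfl
  map_comp f g := rfl

/-- The projection `W_m(R') ×_{W_m(B)} W_{m + n}(B) → W_{m + n}(B)`; in coordinates,
`(r_0, …, r_m, x_{m + 1}, …, x_{m + n}) ↦ (f(r_0), …, f(r_m), x_{m + 1}, …, x_{m + n})`. -/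
noncomputable def shiftedI (m n : ℕ) : D.shifted m n ⟶ Arrow.rightFunc ⋙ D.W (n + m) where
  app a := Under.homMk (CommAlgCat.ofHom
    ((AlgHom.snd Λ _ _).comp (D.shiftedSubalgebra m n a).val)) rfl
  naturality _ _ _ := rfl

/-- The projection `W_m(R') ×_{W_m(B)} W_{m + n}(B) → W_m(R')`. -/
noncomputable def shiftedPr (m n : ℕ) : D.shifted m n ⟶ Arrow.leftFunc ⋙ D.W m where
  app a := Under.homMk (CommAlgCat.ofHom
    ((AlgHom.fst Λ _ _).comp (D.shiftedSubalgebra m n a).val)) rfl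
  naturality _ _ _ := rfl

theorem shiftedPr_comp (m n : ℕ) (a : Arrow (AlgOver Λ R)) :
    (D.shiftedPr m n).app a ≫ (D.W m).map a.hom =
      (D.shiftedI m n).app a ≫ (D.truncNat (Nat.le_add_left m n)).app a.right := by
  ext x
  exact x.2

/-- The homomorphism `E_[m + 1]` from the shifted Witt vectors
`W_{m + 1}(R') ×_{W_{m + 1}(B)} W_{m + 1 + n}(B)` of `R' → B` to the shifted Witt vectors
`W_m(R'^φ) ×_{W_m(B^φ)} W_{m + n}(B^φ)` of `R'^φ → B^φ`; its coordinates are the Frobenius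
polynomials. -/
noncomputable def E (m n : ℕ) :
    D.shifted (m + 1) n ⟶ D.twist.mapArrow ⋙ D.shifted m n where
  app a := Under.homMk (CommAlgCat.ofHom (AlgHom.codRestrict
    ((AlgHom.prodMap ((D.frobNat m).app a.left).right.hom
      ((D.frobNat (n + m)).app a.right).right.hom).comp (D.shiftedSubalgebra (m + 1) n a).val)
    (D.shiftedSubalgebra m n (D.twist.mapArrow.obj a)) (fun x => by
      have h1 := congrArg (fun g => g.right.hom x.1.1) ((D.frobNat m).naturality a.hom)
      have h3 := congrArg ((D.frobNat m).app a.right).right.hom x.2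
      exact h1.symm.trans (h3.trans
        (Witt.trunc_frob (Nat.le_add_left m n) (Nat.le_add_left (m + 1) n) x.1.2).symm)))) (by
      ext r
      have h1 := congrArg (fun g => g.hom r) (Under.w ((D.frobNat m).app a.left))
      have h2 := congrArg (fun g => g.hom r) (Under.w ((D.frobNat (n + m)).app a.right))
      exact Subtype.ext (Prod.ext h1 h2))
  naturality a b f := by
    ext x
    have h1 := congrArg (fun g => g.right.hom x.1.1) ((D.frobNat m).naturality f.left)
    have h2 := congrArg (fun g => g.right.hom x.1.2) ((D.frobNat (n + m)).naturality f.right)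
    exact Subtype.ext (Prod.ext h1 h2)

theorem E_comp_I (m n : ℕ) (a : Arrow (AlgOver Λ R)) :
    (D.E m n).app a ≫ (D.shiftedI m n).app (D.twist.mapArrow.obj a) =
      (D.shiftedI (m + 1) n).app a ≫ (D.frobNat (n + m)).app a.right := rfl

theorem E_comp_Pr (m n : ℕ) (a : Arrow (AlgOver Λ R)) :
    (D.E m n).app a ≫ (D.shiftedPr m n).app (D.twist.mapArrow.obj a) =
      (D.shiftedPr (m + 1) n).app a ≫ (D.frobNat m).app a.left := rfl

/-- `exp_δ : R → W_n(R)` as a homomorphism of `R`-algebras. -/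
noncomputable def expHom (n : ℕ) : baseAlg Λ R ⟶ (D.W n).obj (baseAlg Λ R) :=
  Under.homMk (CommAlgCat.ofHom (D.exp n)) rfl

/-- The functor sending an `R`-algebra `B` to its structure map `R → B`. -/
def strArrow : AlgOver Λ R ⥤ Arrow (AlgOver Λ R) where
  obj B := Arrow.mk (strMap B)
  map {B C} f := Arrow.homMk (𝟙 _) f (base_hom_ext _ _)
  map_id B := rfl
  map_comp f g := by
    ext
    · rfl
    · rfl

variable (X : PiFormalScheme π R)

/-- The arithmetic jet space `J^n X`, with `J^n X (B) = X (W_n(B))`. -/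
noncomputable def jet (n : ℕ) : AlgOver Λ R ⥤ Type u := D.W n ⋙ X.points

/-- The projection `u : J^n X ⟶ J^k X`, for `k ≤ n`. -/
noncomputable def jetProj {k n : ℕ} (hk : k ≤ n) : D.jet X n ⟶ D.jet X k :=
  Functor.whiskerRight (D.truncNat hk) X.points

/-- The Frobenius `φ : J^{n + 1} X ⟶ J^n X` over `φ : S ⟶ S`; it maps `J^{n + 1} X (B)`
to `J^n X (B^φ)`. -/
noncomputable def jetFrob (n : ℕ) : D.jet X (n + 1) ⟶ D.twist ⋙ D.jet X n :=
  Functor.whiskerRight (D.frobNat n) X.points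

variable {X} (P : X.points.obj (baseAlg Λ R))

/-- The marked point `P^n = P ∘ exp_δ` of `J^n X`, an element of `J^n X (R) = X (W_n(R))`. -/
noncomputable def markedPt (n : ℕ) : (D.jet X n).obj (baseAlg Λ R) := X.points.map (D.expHom n) P

/-- The `B`-valued point of `J^n X` given by the marked point `P^n`. -/
noncomputable def markedPtOver (n : ℕ) (B : AlgOver Λ R) : (D.jet X n).obj B :=
  (D.jet X n).map (strMap B) (D.markedPt P n)

theorem markedPtOver_eq (n : ℕ) (B : AlgOver Λ R) (f : baseAlg Λ R ⟶ (D.W n).obj B) :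
    D.markedPtOver P n B = X.points.map f P := by
  rw [base_hom_ext f (D.expHom n ≫ (D.W n).map (strMap B)), Functor.map_comp]
  rfl

theorem map_markedPtOver {k n : ℕ} {B C : AlgOver Λ R} (f : (D.W n).obj B ⟶ (D.W k).obj C) :
    X.points.map f (D.markedPtOver P n B) = D.markedPtOver P k C := by
  rw [D.markedPtOver_eq P n B (strMap _), D.markedPtOver_eq P k C (strMap _ ≫ f),
    Functor.map_comp]
  rfl

/-- The generalized kernel `N^{[m]n} X = J^{m + n} X ×_{J^m X} S`, the fibre of the projection
`u : J^{m + n} X ⟶ J^m X` over the marked point `P^m`. -/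
noncomputable def kernel (m n : ℕ) : AlgOver Λ R ⥤ Type u where
  obj B := { g : (D.jet X (n + m)).obj B //
    (D.jetProj X (Nat.le_add_left m n)).app B g = D.markedPtOver P m B }
  map f := TypeCat.ofHom fun g => ⟨(D.jet X (n + m)).map f g.1, by
    have h1 := congrArg (fun t => t g.1) ((D.jetProj X (Nat.le_add_left m n)).naturality f)
    refine h1.trans ((congrArg ((D.jet X m).map f) g.2).trans ?_)
    exact D.map_markedPtOver P ((D.W m).map f)⟩
  map_id _ := by
    ext g
    simp
  map_comp f g := by
    ext g
    simp

/-- The projection `ι_m : N^{[m]n} X ⟶ J^{m + n} X` of the fibre product. -/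
noncomputable def kernelι (m n : ℕ) : D.kernel P m n ⟶ D.jet X (n + m) where
  app _ := TypeCat.ofHom fun g => g.1
  naturality _ _ _ := rfl

/-- For a homomorphism `a : R' → B` of `R`-algebras, the points of `X` with values in
`W_m(R') ×_{W_m(B)} W_{m + n}(B)` whose restriction along
`Spf W_m(R') ⟶ Spf (W_m(R') ×_{W_m(B)} W_{m + n}(B))` is the marked point `P^m`. -/
noncomputable def shiftedPts (m n : ℕ) : Arrow (AlgOver Λ R) ⥤ Type u where
  obj a := { f : X.points.obj ((D.shifted m n).obj a) //
    X.points.map ((D.shiftedPr m n).app a) f = D.markedPtOver P m a.left }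
  map {a b} t := TypeCat.ofHom fun f => ⟨X.points.map ((D.shifted m n).map t) f.1, by
    have h1 := congrArg (fun s => X.points.map s f.1) ((D.shiftedPr m n).naturality t)
    simp only [Functor.map_comp, ConcreteCategory.comp_apply] at h1
    refine h1.trans ((congrArg _ f.2).trans ?_)
    exact D.map_markedPtOver P ((D.W m).map t.left)⟩
  map_id _ := by
    ext g
    simp
  map_comp f g := by
    ext g
    simp

/-- The description of `N^{[m]n} X` through shifted Witt vectors: the map from `shiftedPts` to
`N^{[m]n} X` induced by `I_[m]n`, sending `f` to `f ∘ Spf (I_[m]n)`. -/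
noncomputable def shiftedPtsToKernel (m n : ℕ) :
    D.shiftedPts P m n ⟶ Arrow.rightFunc ⋙ D.kernel P m n where
  app a := TypeCat.ofHom fun f => ⟨X.points.map ((D.shiftedI m n).app a) f.1, by
    have h1 := congrArg (fun s => X.points.map s f.1) (D.shiftedPr_comp m n a)
    refine ((X.map_comp_apply _ _ _).symm.trans h1.symm).trans
      ((X.map_comp_apply _ _ _).trans ((congrArg _ f.2).trans ?_))
    exact D.map_markedPtOver P ((D.W m).map a.hom)⟩
  naturality a b t := by
    ext f
    have h1 := congrArg (fun s => X.points.map s f.1) ((D.shiftedI m n).naturality t)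
    simp only [Functor.map_comp, ConcreteCategory.comp_apply] at h1
    exact Subtype.ext h1

/-- The map `X(E_[m + 1])` on points with values in shifted Witt vectors. -/
noncomputable def shiftedPhi (m n : ℕ) :
    D.shiftedPts P (m + 1) n ⟶ D.twist.mapArrow ⋙ D.shiftedPts P m n where
  app a := TypeCat.ofHom fun f => ⟨X.points.map ((D.E m n).app a) f.1, by
    have h1 := congrArg (fun s => X.points.map s f.1) (D.E_comp_Pr m n a)
    refine ((X.map_comp_apply _ _ _).symm.trans h1).trans
      ((X.map_comp_apply _ _ _).trans ((congrArg _ f.2).trans ?_))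
    exact D.map_markedPtOver P ((D.frobNat m).app a.left)⟩
  naturality a b t := by
    ext f
    have h1 := congrArg (fun s => X.points.map s f.1) ((D.E m n).naturality t)
    simp only [Functor.map_comp, ConcreteCategory.comp_apply] at h1
    exact Subtype.ext h1

/-! The same functors on the category of `π`-adically complete `R`-algebras. -/

variable (Λ) in
/-- The category of `π`-adically complete `R`-algebras. -/
abbrev PiAlg (π : Λ) (R : Type u) [CommRing R] [Algebra Λ R] := (isPiComplete π R).FullSubcategory

/-- The functor `B ↦ B^φ` on `π`-adically complete `R`-algebras. -/
def twistC : PiAlg Λ π R ⥤ PiAlg Λ π R :=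
  (isPiComplete π R).lift ((isPiComplete π R).ι ⋙ D.twist) fun B => B.property

variable (X) in
/-- The jet space `J^n X`, as a functor on `π`-adically complete `R`-algebras. -/
noncomputable def J (n : ℕ) : PiAlg Λ π R ⥤ Type u := (isPiComplete π R).ι ⋙ D.jet X n

variable (X) in
/-- The Frobenius `φ : J^{n + 1} X ⟶ J^n X` over `φ : S ⟶ S`. -/
noncomputable def φJ (n : ℕ) : D.J X (n + 1) ⟶ D.twistC ⋙ D.J X n :=
  Functor.whiskerLeft (isPiComplete π R).ι (D.jetFrob X n)

/-- The generalized kernel `N^{[m]n} X = J^{m + n} X ×_{J^m X} S`, as a functor on `π`-adically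
complete `R`-algebras. -/
noncomputable def N (m n : ℕ) : PiAlg Λ π R ⥤ Type u := (isPiComplete π R).ι ⋙ D.kernel P m n

/-- The morphism `ι_m : N^{[m]n} X ⟶ J^{m + n} X`. -/
noncomputable def ι (m n : ℕ) : D.N P m n ⟶ D.J X (n + m) :=
  Functor.whiskerLeft (isPiComplete π R).ι (D.kernelι P m n)

/-- The functor `B ↦ {f ∈ X(W_[m]n(B)) | f ∘ i_m = P^m}`, where
`W_[m]n(B) = W_m(R) ×_{W_m(B)} W_{m + n}(B)`. -/
noncomputable def NShift (m n : ℕ) : PiAlg Λ π R ⥤ Type u :=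
  ((isPiComplete π R).ι ⋙ strArrow) ⋙ D.shiftedPts P m n

/-- The functor `B ↦ {f ∈ X(W_[m]n(B^φ)) | f ∘ i_m = P^m}`, where
`W_[m]n(B^φ) = W_m(R^φ) ×_{W_m(B^φ)} W_{m + n}(B^φ)`. -/
noncomputable def NShiftTwist (m n : ℕ) : PiAlg Λ π R ⥤ Type u :=
  ((isPiComplete π R).ι ⋙ strArrow) ⋙ D.twist.mapArrow ⋙ D.shiftedPts P m n

/-- The comparison map from `NShift` to the fibre product `N^{[m]n} X`, given by
`f ↦ f ∘ Spf (I_[m]n)`. -/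
noncomputable def shiftToN (m n : ℕ) : D.NShift P m n ⟶ D.N P m n :=
  Functor.whiskerLeft ((isPiComplete π R).ι ⋙ strArrow) (D.shiftedPtsToKernel P m n)

/-- The comparison map from `NShiftTwist` to `B ↦ N^{[m]n} X (B^φ)`, given by
`f ↦ f ∘ Spf (I_[m]n)`. -/
noncomputable def shiftTwistToN (m n : ℕ) : D.NShiftTwist P m n ⟶ D.twistC ⋙ D.N P m n :=
  { app := fun B => (D.shiftedPtsToKernel P m n).app (D.twist.mapArrow.obj (strArrow.obj B.obj))
    naturality := fun _ _ f =>
      (D.shiftedPtsToKernel P m n).naturality (D.twist.mapArrow.map (strArrow.map f.hom)) }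

/-- The morphism `Φ_[m + 1]` in terms of shifted Witt vectors: it maps
`f ∈ X(W_[m + 1]n(B))` to `X(E_[m + 1])(f) ∈ X(W_[m]n(B^φ))`. -/
noncomputable def PhiShift (m n : ℕ) : D.NShift P (m + 1) n ⟶ D.NShiftTwist P m n :=
  Functor.whiskerLeft ((isPiComplete π R).ι ⋙ strArrow) (D.shiftedPhi P m n)

end DeltaRing

end Functors

/-- The standing situation: `O` is a Dedekind domain, `𝔭` a nonzero prime ideal with finite residue
field, and `π` a generator of the maximal ideal of the local ring of `O` at `𝔭`. -/
theorem FrobBase.ofDedekind {O : Type v} [CommRing O] [IsDedekindDomain O] (𝔭 : Ideal O)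
    [𝔭.IsPrime] (h𝔭 : 𝔭 ≠ ⊥) [Finite (O ⧸ 𝔭)] (π : Localization.AtPrime 𝔭)
    (hπ : IsLocalRing.maximalIdeal (Localization.AtPrime 𝔭) = Ideal.span {π}) :
    FrobBase π (Nat.card (O ⧸ 𝔭)) := by
  have hmax : 𝔭.IsMaximal := Ideal.IsPrime.isMaximal inferInstance h𝔭
  let _ := Ideal.Quotient.field 𝔭
  let _ := Fintype.ofFinite (O ⧸ 𝔭)
  have : IsDomain (Localization.AtPrime 𝔭) :=
    IsLocalization.isDomain_localization 𝔭.primeCompl_le_nonZeroDivisors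
  refine ⟨?_, ?_, fun a => ?_⟩
  · rw [mem_nonZeroDivisors_iff_ne_zero]
    rintro rfl
    apply h𝔭
    have h1 := IsLocalization.AtPrime.under_maximalIdeal (Localization.AtPrime 𝔭) 𝔭
    rw [← h1, hπ, Ideal.span_singleton_zero]
    exact (RingHom.injective_iff_ker_eq_bot _).1
      (IsLocalization.injective _ 𝔭.primeCompl_le_nonZeroDivisors)
  · obtain ⟨p, hp⟩ := CharP.exists (O ⧸ 𝔭)
    obtain ⟨k, hpp, hk⟩ := FiniteField.card (O ⧸ 𝔭) p
    refine ⟨p, k, hpp, k.2, by rw [Nat.card_eq_fintype_card, hk], ?_⟩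
    have h0 : (p : O) ∈ 𝔭 := by
      rw [← Ideal.Quotient.eq_zero_iff_mem]
      simp
    rw [← hπ, ← map_natCast (algebraMap O (Localization.AtPrime 𝔭)),
      ← Ideal.mem_comap, ← Ideal.under_def, IsLocalization.AtPrime.under_maximalIdeal (Localization.AtPrime 𝔭) 𝔭]
    exact h0
  · rw [← hπ, ← Ideal.Quotient.eq_zero_iff_mem, map_sub, map_pow, sub_eq_zero]
    let e := IsLocalization.AtPrime.equivQuotMaximalIdeal 𝔭 (Localization.AtPrime 𝔭)
    apply e.symm.injective
    rw [map_pow, Nat.card_eq_fintype_card]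
    exact FiniteField.pow_card _

end PiJet

/-!
Since `N^{[m]n} X` is a fibre of the truncation `u : J^{m + n} X ⟶ J^m X`, the morphism `ι_m` is a
monomorphism, and a morphism into `N^{[m]n} X` is the same as a morphism into `J^{m + n} X` which
`u` sends to the marked point. This gives at most one `Φ` with `φ ∘ ι_{m + 1} = ι_m ∘ Φ`, and it
gives one as soon as `φ ∘ ι_{m + 1}` lands in the fibre over `P^m`. The latter holds because `u`
commutes with `φ` (truncation commutes with the Frobenius of Witt vectors, `frobNat_comp_truncNat`)
and because `φ` maps marked points to marked points: the Frobenius of Witt vectors is a homomorphism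
of `R`-algebras `W_{m + 1}(B) → W_m(B^φ)`, and such homomorphisms preserve the images of `P`
(`map_markedPtOver`). The result is `DeltaRing.kernelFrob`.

The compatibility of `X(E_[m + 1])` with `φ` follows from `I_[m]n ∘ E_[m + 1] = F ∘ I_[m + 1]n` by
functoriality of `X`. The remaining identity `Φ ∘ κ_{m + 1} = κ_m ∘ X(E_[m + 1])` is then checked
after composition with the monomorphism `ι_m`.
-/

namespace PiJet.DeltaRing

variable {Λ : Type v} [CommRing Λ] {π : Λ} {q : ℕ} {h : FrobBase π q} {R : Type u} [CommRing R]
  [Algebra Λ R] (D : DeltaRing h R)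

/-- Truncation commutes with the Frobenius of Witt vectors, as homomorphisms of `R`-algebras. -/
theorem frobNat_comp_truncNat (m n : ℕ) (B : AlgOver Λ R) :
    (D.frobNat (n + m)).app B ≫ (D.truncNat (Nat.le_add_left m n)).app (D.twist.obj B) =
      (D.truncNat (Nat.le_add_left (m + 1) n)).app B ≫ (D.frobNat m).app B := by
  ext x
  exact Witt.trunc_frob (Nat.le_add_left m n) (Nat.le_add_left (m + 1) n) x

variable {X : PiFormalScheme π R} (P : X.points.obj (baseAlg Λ R))

/-- The Frobenius `φ : J^{m + 1 + n} X ⟶ J^{m + n} X` maps the fibre over `P^{m + 1}` to the fibre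
over `P^m`. -/
theorem jetProj_jetFrob_eq (m n : ℕ) (B : AlgOver Λ R) (g : (D.kernel P (m + 1) n).obj B) :
    (D.jetProj X (Nat.le_add_left m n)).app (D.twist.obj B) ((D.jetFrob X (n + m)).app B g.1) =
      D.markedPtOver P m (D.twist.obj B) := by
  have h1 := congrArg (fun t => X.points.map t g.1) (D.frobNat_comp_truncNat m n B)
  refine ((X.map_comp_apply _ _ _).symm.trans h1).trans
    ((X.map_comp_apply _ _ _).trans ((congrArg _ g.2).trans ?_))
  exact D.map_markedPtOver P ((D.frobNat m).app B)

/-- The morphism `N^{[m + 1]n} X ⟶ N^{[m]n} X` over `φ : S ⟶ S` obtained by restricting the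
Frobenius of jet spaces to the fibres over the marked points. -/
noncomputable def kernelFrob (m n : ℕ) : D.kernel P (m + 1) n ⟶ D.twist ⋙ D.kernel P m n where
  app B := TypeCat.ofHom fun g => ⟨(D.jetFrob X (n + m)).app B g.1, D.jetProj_jetFrob_eq P m n B g⟩
  naturality B C f := by
    ext g
    exact Subtype.ext (congrArg (fun t => t g.1) ((D.jetFrob X (n + m)).naturality f))

/-- A morphism over `φ : S ⟶ S` with values in `N^{[m]n} X` is determined by its composite with
`ι_m`. -/
theorem comp_ι_injective (m n : ℕ) {Y : PiAlg Λ π R ⥤ Type u}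
    {Φ Ψ : Y ⟶ D.twistC ⋙ D.N P m n}
    (hΦ : Φ ≫ Functor.whiskerLeft D.twistC (D.ι P m n) =
      Ψ ≫ Functor.whiskerLeft D.twistC (D.ι P m n)) : Φ = Ψ := by
  ext B y
  exact Subtype.ext (congrArg (fun t => t.app B y) hΦ)

/-- `X(E_[m + 1])` is compatible with the Frobenius of jet spaces. -/
theorem PhiShift_comp_ι (m n : ℕ) :
    D.PhiShift P m n ≫ D.shiftTwistToN P m n ≫ Functor.whiskerLeft D.twistC (D.ι P m n) =
      (D.shiftToN P (m + 1) n ≫ D.ι P (m + 1) n) ≫ D.φJ X (n + m) := by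
  ext B f
  have h1 := congrArg (fun s => X.points.map s f.1) (D.E_comp_I m n (strArrow.obj B.obj))
  exact (X.map_comp_apply _ _ _).symm.trans (h1.trans (X.map_comp_apply _ _ _))

end PiJet.DeltaRing

theorem mainTheorem4 {O : Type v} [CommRing O] [IsDedekindDomain O] (𝔭 : Ideal O) [𝔭.IsPrime]
    (h𝔭 : 𝔭 ≠ ⊥) [Finite (O ⧸ 𝔭)] (π : Localization.AtPrime 𝔭)
    (hπ : IsLocalRing.maximalIdeal (Localization.AtPrime 𝔭) = Ideal.span {π})
    {R : Type u} [CommRing R] [IsDomain R] [IsDiscreteValuationRing R]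
    [Algebra (Localization.AtPrime 𝔭) R]
    [IsAdicComplete (Ideal.span {algebraMap (Localization.AtPrime 𝔭) R π}) R]
    (D : PiJet.DeltaRing (PiJet.FrobBase.ofDedekind 𝔭 h𝔭 π hπ) R)
    (X : PiJet.PiFormalScheme π R)
    (P : X.points.obj (PiJet.baseAlg (Localization.AtPrime 𝔭) R)) (m n : ℕ) :
    D.PhiShift P m n ≫ D.shiftTwistToN P m n ≫ Functor.whiskerLeft D.twistC (D.ι P m n) =
      (D.shiftToN P (m + 1) n ≫ D.ι P (m + 1) n) ≫ D.φJ X (n + m) ∧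
    ∃! Φ : D.N P (m + 1) n ⟶ D.twistC ⋙ D.N P m n,
      D.shiftToN P (m + 1) n ≫ Φ = D.PhiShift P m n ≫ D.shiftTwistToN P m n ∧
      Φ ≫ Functor.whiskerLeft D.twistC (D.ι P m n) = D.ι P (m + 1) n ≫ D.φJ X (n + m) := by
  have hΦ : Functor.whiskerLeft (PiJet.isPiComplete π R).ι (D.kernelFrob P m n) ≫
      Functor.whiskerLeft D.twistC (D.ι P m n) = D.ι P (m + 1) n ≫ D.φJ X (n + m) := rfl
  refine ⟨D.PhiShift_comp_ι P m n, Functor.whiskerLeft (PiJet.isPiComplete π R).ι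
    (D.kernelFrob P m n), ⟨D.comp_ι_injective P m n ?_, hΦ⟩, fun Ψ hΨ =>
    D.comp_ι_injective P m n (hΨ.2.trans hΦ.symm)⟩
  exact ((Category.assoc _ _ _).trans (congrArg (D.shiftToN P (m + 1) n ≫ ·) hΦ)).trans
    ((Category.assoc _ _ _).symm.trans ((D.PhiShift_comp_ι P m n).symm.trans
      (Category.assoc _ _ _).symm))
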